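/- For a finite alphabet $A$, let $\widetilde A = A\cup A^{-1}$, let $F_A$ be the free group on $A$, and let $\theta:\widetilde A^*\to F_A$ be the canonical monoid morphism. A subset $X\subseteq F_A$ is called \emph{rational} if $X=\theta(L)$ for some regular language $L\subseteq\widetilde A^*$, and \emph{recognizable} if its full preimage $\theta^{-1}(X)$ is a regular language in $\widetilde A^*$. \textbf{Proposition.} It is decidable whether or not a rational subset of $F_A$ is recognizable. That is, there is an algorithm which, given a number $n$ and a finite automaton over $\widetilde A$, where $A=\{a_0,\dots,a_{n-1}\}$, accepting a language $L$, decides whether the rational subset $\theta(L)$ of $F_A$ is recognizable. -/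

import Mathlib

namespace RatFree

/-- A subset of the free group `F_A` is rational if it is the image of a regular language over
`A ∪ A⁻¹` under the canonical map `(A ∪ A⁻¹)* → F_A`. The letter `(a, true)` stands for `a` and
`(a, false)` for `a⁻¹`, as in Mathlib's `FreeGroup`. -/
def IsRational {A : Type*} (X : Set (FreeGroup A)) : Prop :=
  ∃ L : Language (A × Bool), L.IsRegular ∧
    X = (FreeGroup.mk : List (A × Bool) → FreeGroup A) '' (L : Set (List (A × Bool)))

/-- The full preimage of a subset of `F_A` under the canonical map `(A ∪ A⁻¹)* → F_A`. -/
def preimageLanguage {A : Type*} (X : Set (FreeGroup A)) : Language (A × Bool) :=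
  {w : List (A × Bool) | FreeGroup.mk w ∈ X}

/-- A subset of the free group `F_A` is recognizable if its full preimage under the canonical map
`(A ∪ A⁻¹)* → F_A` is a regular language. -/
def IsRecognizable {A : Type*} (X : Set (FreeGroup A)) : Prop :=
  (preimageLanguage X).IsRegular

/-- Finite nondeterministic automata over the alphabet `{a₀, …, aₙ₋₁} ∪ {a₀⁻¹, …, aₙ₋₁⁻¹}`, written
out as finite data `(n, m, I, T, E)`: the number `n` of generators, the number `m` of states
(the states are `0, …, m - 1`), the lists `I` and `T` of initial and of final states, and the
list `E` of edges. An edge `(p, (i, true), q)` goes from `p` to `q` with label `aᵢ`, and an edge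
`(p, (i, false), q)` goes from `p` to `q` with label `aᵢ⁻¹`. List entries that name a state `≥ m`
or a generator `≥ n` are ignored. -/
abbrev AutomatonCode : Type :=
  ℕ × ℕ × List ℕ × List ℕ × List (ℕ × (ℕ × Bool) × ℕ)

namespace AutomatonCode

/-- The number of generators. -/
abbrev rank (c : AutomatonCode) : ℕ := c.1

/-- The number of states. -/
abbrev numStates (c : AutomatonCode) : ℕ := c.2.1

/-- The list of initial states. -/
abbrev initial (c : AutomatonCode) : List ℕ := c.2.2.1

/-- The list of final states. -/
abbrev final (c : AutomatonCode) : List ℕ := c.2.2.2.1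

/-- The list of edges. -/
abbrev edges (c : AutomatonCode) : List (ℕ × (ℕ × Bool) × ℕ) := c.2.2.2.2

/-- The automaton that is written out by a code. -/
def toNFA (c : AutomatonCode) : NFA (Fin c.rank × Bool) (Fin c.numStates) where
  step p x := {q | ((p : ℕ), ((x.1 : ℕ), x.2), (q : ℕ)) ∈ c.edges}
  start := {p | (p : ℕ) ∈ c.initial}
  accept := {p | (p : ℕ) ∈ c.final}

/-- The subset of the free group on `c.rank` generators that a code describes: the image, under
the canonical map, of the language accepted by the automaton. -/
def ratSubset (c : AutomatonCode) : Set (FreeGroup (Fin c.rank)) :=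
  (FreeGroup.mk : List (Fin c.rank × Bool) → FreeGroup (Fin c.rank)) ''
    (c.toNFA.accepts : Set (List (Fin c.rank × Bool)))

/-- Every code describes a rational subset. -/
theorem isRational_ratSubset (c : AutomatonCode) : IsRational c.ratSubset := by
  classical
  exact ⟨c.toNFA.accepts, ⟨Set (Fin c.numStates), inferInstance, c.toNFA.toDFA,
    NFA.toDFA_correct⟩, rfl⟩

/-- Every rational subset of a free group on `n` generators is described by a code. -/
theorem exists_code_of_isRational {n : ℕ} {X : Set (FreeGroup (Fin n))} (hX : IsRational X) :
    ∃ (m : ℕ) (I T : List ℕ) (E : List (ℕ × (ℕ × Bool) × ℕ)),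
      ratSubset (n, m, I, T, E) = X := by
  classical
  obtain ⟨L, ⟨σ, hσ, M, rfl⟩, rfl⟩ := hX
  let e := Fintype.equivFin σ
  let M' : DFA (Fin n × Bool) (Fin (Fintype.card σ)) := DFA.reindex e M
  refine ⟨Fintype.card σ, [(M'.start : ℕ)],
    (Finset.univ.filter (· ∈ M'.accept)).toList.map Fin.val,
    (Finset.univ : Finset (Fin (Fintype.card σ) × (Fin n × Bool))).toList.map
      (fun t => ((t.1 : ℕ), ((t.2.1 : ℕ), t.2.2), (M'.step t.1 t.2 : ℕ))), ?_⟩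
  have h : toNFA (n, Fintype.card σ, [(M'.start : ℕ)],
      (Finset.univ.filter (· ∈ M'.accept)).toList.map Fin.val,
      (Finset.univ : Finset (Fin (Fintype.card σ) × (Fin n × Bool))).toList.map
      (fun t => ((t.1 : ℕ), ((t.2.1 : ℕ), t.2.2), (M'.step t.1 t.2 : ℕ)))) = M'.toNFA := by
    unfold toNFA DFA.toNFA
    congr 1
    · funext p x
      ext q
      obtain ⟨i, b⟩ := x
      simp only [edges, Set.mem_ofPred_eq, List.mem_map, Finset.mem_toList, Finset.mem_univ, true_and,
        Prod.mk.injEq, Prod.exists, Set.mem_singleton_iff]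
      constructor
      · rintro ⟨p', i', b', h1, ⟨h2, h3⟩, h4⟩
        rw [Fin.val_inj] at h1 h2 h4
        rw [← h4, h1, h2, h3]
      · rintro rfl
        exact ⟨p, i, b, rfl, ⟨rfl, rfl⟩, rfl⟩
    · ext q
      simp [initial, Fin.val_inj]
    · ext q
      simp [final, Fin.val_inj]
  unfold ratSubset
  rw [h, DFA.toNFA_correct, DFA.accepts_reindex]

end AutomatonCode

end RatFree

/-! Let X be the described subset. By Myhill-Nerode (`isRecognizable_iff`), X is recognizable iff it
has finitely many left translates g⁻¹X. Saturating the automaton by all transitions whose path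
labels reduce to length at most one gives `mk_mem_carrier_iff`: membership of a group element is
read off by running its reduced word deterministically on lists of states.

Give a reduced word the type (last letter, states reached); there are finitely many types. If the
type determines the translate, X is recognizable. Conversely, suppose g and h have the same type,
with last letter x, but z separates their translates. If there were finitely many translates, some
power x^m with m > |z| would fix both of them. Then x^m z reduces to a word starting with x, which
does not cancel against g or h, so both runs continue from the same states along the same letters
and z cannot separate. So a triple (g, h, z) certifies non-recognizability (`exists_separates`,
`Separates.not_finite`).

Recognizability is certified by a finite action of the free group through which membership factors
(`exists_recognizes`, `Recognizes.finite`). Both kinds of certificate are primitive recursively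
checkable, so the property and its complement are r.e., and Post's theorem concludes. -/

open FreeGroup

namespace RatFree

/-! ### Reduced words. -/

/-- The formal inverse of a letter. -/
def bar (x : ℕ × Bool) : ℕ × Bool := (x.1, !x.2)

theorem ne_bar_iff {x y : ℕ × Bool} : x ≠ bar y ↔ (x.1 = y.1 → x.2 = y.2) := by
  obtain ⟨i, b⟩ := x
  obtain ⟨j, d⟩ := y
  cases b <;> cases d <;> simp [bar]

theorem mk_bar (x : ℕ × Bool) : (mk [bar x] : FreeGroup ℕ) = (mk [x])⁻¹ := by
  simp [bar, inv_mk, invRev]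

theorem mk_eq_iff {u v : List (ℕ × Bool)} : mk u = mk v ↔ reduce u = reduce v :=
  ⟨reduce.sound, reduce.exact⟩

theorem reduce_cons_eq (x : ℕ × Bool) (w : List (ℕ × Bool)) :
    reduce (x :: w) =
      if (reduce w).head? = some (bar x) then (reduce w).tail else x :: reduce w := by
  rw [reduce.cons]
  rcases reduce w with _ | ⟨y, t⟩
  · simp
  · obtain ⟨i, b⟩ := x
    obtain ⟨j, d⟩ := y
    cases b <;> cases d <;> simp [bar, eq_comm]

theorem isReduced_append_iff {u v : List (ℕ × Bool)} :
    IsReduced (u ++ v) ↔ IsReduced u ∧ IsReduced v ∧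
      ∀ x ∈ u.getLast?, ∀ y ∈ v.head?, x ≠ bar y := by
  simp only [FreeGroup.IsReduced, List.isChain_append, ne_bar_iff]

theorem isReduced_concat_iff {u : List (ℕ × Bool)} {x : ℕ × Bool} :
    IsReduced (u ++ [x]) ↔ IsReduced u ∧ u.getLast? ≠ some (bar x) := by
  rw [isReduced_append_iff]
  simp only [IsReduced.singleton, List.head?_cons, Option.mem_def, Option.some.injEq, forall_eq',
    true_and, and_congr_right_iff]
  refine fun _ => ⟨fun h h' => h _ h' rfl, fun h y hy e => h (e ▸ hy)⟩

theorem isReduced_reduce (w : List (ℕ × Bool)) : IsReduced (reduce w) := by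
  rw [isReduced_iff_reduce_eq]
  exact reduce.idem

/-- Prepending a power of a letter longer than the word leaves that letter in front. -/
theorem reduce_replicate_append (x : ℕ × Bool) (z : List (ℕ × Bool)) (m : ℕ) :
    (∃ t, reduce (List.replicate m x ++ z) = x :: t) ∨
      (reduce (List.replicate m x ++ z)).length + m ≤ z.length := by
  induction m with
  | zero => right; simpa using (reduce.red (L := z)).length_le
  | succ m ih =>
    rw [List.replicate_succ, List.cons_append, reduce_cons_eq]
    rcases ih with ⟨t, ht⟩ | h
    · left
      rw [ht, if_neg]
      · exact ⟨_, rfl⟩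
      · obtain ⟨i, b⟩ := x
        simp [bar]
    · split_ifs with h'
      · right
        rcases hr : reduce (List.replicate m x ++ z) with _ | ⟨y, t⟩
        · simp [hr] at h'
        · simp only [hr, List.length_cons, List.tail_cons] at h ⊢
          omega
      · left
        exact ⟨_, rfl⟩

namespace AutomatonCode

/-! ### Paths, and transfer to the free group on `ℕ`. -/

/-- The edges of the automaton written out by a code. -/
def Edge (c : AutomatonCode) (p : ℕ) (x : ℕ × Bool) (q : ℕ) : Prop :=
  (p, x, q) ∈ c.edges ∧ p < c.numStates ∧ q < c.numStates ∧ x.1 < c.rank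

/-- The word `w` labels a path from `p` to `q`. -/
def Path (c : AutomatonCode) : ℕ → List (ℕ × Bool) → ℕ → Prop
  | p, [], q => p = q ∧ p < c.numStates
  | p, x :: w, q => ∃ r, c.Edge p x r ∧ Path c r w q

/-- The words over the first `c.rank` generators. -/
def Valid (c : AutomatonCode) (w : List (ℕ × Bool)) : Prop := ∀ x ∈ w, x.1 < c.rank

/-- The subset described by a code, inside the free group on `ℕ`. -/
def carrier (c : AutomatonCode) : Set (FreeGroup ℕ) :=
  {g | ∃ p ∈ c.initial, ∃ q ∈ c.final, ∃ w, c.Path p w q ∧ mk w = g}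

variable {c : AutomatonCode}

theorem Path.left_lt {p q : ℕ} {w : List (ℕ × Bool)} (h : c.Path p w q) : p < c.numStates := by
  cases w with
  | nil => exact h.2
  | cons x w => exact h.choose_spec.1.2.1

theorem path_append_iff {p q : ℕ} {u v : List (ℕ × Bool)} :
    c.Path p (u ++ v) q ↔ ∃ r, c.Path p u r ∧ c.Path r v q := by
  induction u generalizing p with
  | nil =>
    simp only [List.nil_append, Path]
    refine ⟨fun h => ⟨p, ⟨rfl, h.left_lt⟩, h⟩, ?_⟩
    rintro ⟨r, ⟨rfl, -⟩, h⟩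
    exact h
  | cons x u ih =>
    simp only [List.cons_append, Path, ih]
    constructor
    · rintro ⟨s, hs, r, h1, h2⟩
      exact ⟨r, ⟨s, hs, h1⟩, h2⟩
    · rintro ⟨r, ⟨s, hs, h1⟩, h2⟩
      exact ⟨s, hs, r, h1, h2⟩

theorem Path.right_lt {p q : ℕ} {w : List (ℕ × Bool)} (h : c.Path p w q) : q < c.numStates := by
  induction w generalizing p with
  | nil => exact h.1 ▸ h.2
  | cons x w ih => exact ih h.choose_spec.2

theorem Path.valid {p q : ℕ} {w : List (ℕ × Bool)} (h : c.Path p w q) : c.Valid w := by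
  induction w generalizing p with
  | nil => simp [Valid]
  | cons x w ih =>
    obtain ⟨r, h1, h2⟩ := h
    intro y hy
    rcases List.mem_cons.1 hy with rfl | hy
    · exact h1.2.2.2
    · exact ih h2 y hy

theorem Valid.reduce {w : List (ℕ × Bool)} (h : c.Valid w) : c.Valid (reduce w) :=
  fun x hx => h x (reduce.red.sublist.subset hx)

theorem valid_append {u v : List (ℕ × Bool)} : c.Valid (u ++ v) ↔ c.Valid u ∧ c.Valid v := by
  simp [Valid, or_imp, forall_and]

/-- Forgetting that the generators of the code are bounded by the rank. -/
def unbound (c : AutomatonCode) (w : List (Fin c.rank × Bool)) : List (ℕ × Bool) :=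
  w.map fun x => ((x.1 : ℕ), x.2)

theorem valid_unbound (w : List (Fin c.rank × Bool)) : c.Valid (c.unbound w) := by
  intro x hx
  obtain ⟨y, -, rfl⟩ := List.mem_map.1 hx
  exact y.1.2

theorem Valid.exists_unbound {w : List (ℕ × Bool)} (h : c.Valid w) : ∃ v, c.unbound v = w := by
  induction w with
  | nil => exact ⟨[], rfl⟩
  | cons x w ih =>
    obtain ⟨v, rfl⟩ := ih fun y hy => h y (List.mem_cons_of_mem _ hy)
    exact ⟨(⟨x.1, h x List.mem_cons_self⟩, x.2) :: v, rfl⟩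

theorem mem_evalFrom_iff {p q : Fin c.numStates} {w : List (Fin c.rank × Bool)} :
    q ∈ c.toNFA.evalFrom {p} w ↔ c.Path p (c.unbound w) q := by
  induction w generalizing p with
  | nil => simp [unbound, Path, Fin.val_inj, eq_comm]
  | cons x w ih =>
    rw [NFA.evalFrom_cons, NFA.stepSet_singleton, NFA.mem_evalFrom_iff_exists]
    simp only [ih]
    constructor
    · rintro ⟨r, hr, h⟩
      exact ⟨r, ⟨hr, p.2, r.2, x.1.2⟩, h⟩
    · rintro ⟨r, hr, h⟩
      exact ⟨⟨r, hr.2.2.1⟩, hr.1, h⟩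

/-- The inclusion of generators induces an injective map of free groups, so nothing is lost by
working in one group that does not depend on the code. -/
theorem mk_mem_ratSubset_iff {w : List (Fin c.rank × Bool)} :
    mk w ∈ c.ratSubset ↔ mk (c.unbound w) ∈ c.carrier := by
  have key : ∀ v, (mk v : FreeGroup (Fin c.rank)) = mk w ↔
      mk (c.unbound v) = mk (c.unbound w) := fun v => by
    rw [← (map_injective Fin.val_injective).eq_iff, map.mk, map.mk]
    rfl
  constructor
  · rintro ⟨v, hv, e⟩
    obtain ⟨q, hq, h⟩ := hv
    obtain ⟨p, hp, h⟩ := NFA.mem_evalFrom_iff_exists.1 h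
    exact ⟨p, hp, q, hq, _, mem_evalFrom_iff.1 h, (key v).1 e⟩
  · rintro ⟨p, hp, q, hq, v', h, e⟩
    obtain ⟨v, rfl⟩ := h.valid.exists_unbound
    refine ⟨v, ?_, (key v).2 e⟩
    exact ⟨⟨q, h.right_lt⟩, hq, NFA.mem_evalFrom_iff_exists.2
      ⟨⟨p, h.left_lt⟩, hp, mem_evalFrom_iff.2 h⟩⟩

/-! ### Left translates and Myhill-Nerode. -/

/-- The left translate `g⁻¹ X` of the subset `X` that a code describes. -/
def translate (c : AutomatonCode) (g : FreeGroup ℕ) : Set (FreeGroup ℕ) := {z | g * z ∈ c.carrier}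

theorem mem_translate {g z : FreeGroup ℕ} : z ∈ c.translate g ↔ g * z ∈ c.carrier := Iff.rfl

theorem translate_mul_inj {g h u : FreeGroup ℕ} :
    c.translate (g * u) = c.translate (h * u) ↔ c.translate g = c.translate h := by
  simp only [Set.ext_iff, mem_translate, mul_assoc]
  exact ⟨fun H z => by simpa using H (u⁻¹ * z), fun H z => H _⟩

/-- The left translates by elements of the free group on the first `c.rank` generators. -/
def translates (c : AutomatonCode) : Set (Set (FreeGroup ℕ)) :=
  {Y | ∃ w, c.Valid w ∧ c.translate (mk w) = Y}

theorem exists_valid_of_mem_carrier {g : FreeGroup ℕ} (h : g ∈ c.carrier) :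
    ∃ w, c.Valid w ∧ mk w = g := by
  obtain ⟨p, -, q, -, w, hw, rfl⟩ := h
  exact ⟨w, hw.valid, rfl⟩

theorem exists_valid_of_mem_translate {w : List (ℕ × Bool)} (hw : c.Valid w) {g : FreeGroup ℕ}
    (hg : g ∈ c.translate (mk w)) : ∃ z, c.Valid z ∧ mk z = g := by
  obtain ⟨v, hv, e⟩ := exists_valid_of_mem_carrier hg
  refine ⟨invRev w ++ v, valid_append.2 ⟨fun x hx => ?_, hv⟩, ?_⟩
  · rw [invRev, List.mem_reverse] at hx
    obtain ⟨y, hy, rfl⟩ := List.mem_map.1 hx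
    exact hw y hy
  · rw [← mul_mk, ← inv_mk, e, inv_mul_cancel_left]

theorem unbound_append (u v : List (Fin c.rank × Bool)) :
    c.unbound (u ++ v) = c.unbound u ++ c.unbound v := List.map_append ..

/-- Myhill-Nerode: recognizability means that there are finitely many left translates. -/
theorem isRecognizable_iff : IsRecognizable c.ratSubset ↔ c.translates.Finite := by
  rw [IsRecognizable, Language.isRegular_iff_finite_range_leftQuotient]
  have hl : ∀ w z, z ∈ (preimageLanguage c.ratSubset).leftQuotient w ↔
      mk (c.unbound z) ∈ c.translate (mk (c.unbound w)) := fun w z => by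
    rw [Language.mem_leftQuotient, mem_translate, mul_mk, ← unbound_append]
    exact mk_mem_ratSubset_iff
  constructor
  · intro h
    -- Left quotients and translates determine each other: push a quotient forward to the group
    -- here, pull a translate back to words in the converse.
    refine (h.image fun L => {g | ∃ z ∈ L, mk (c.unbound z) = g}).subset ?_
    rintro Y ⟨w, hw, rfl⟩
    obtain ⟨w, rfl⟩ := hw.exists_unbound
    refine ⟨_, ⟨w, rfl⟩, ?_⟩
    ext g
    constructor
    · rintro ⟨z, hz, rfl⟩
      exact (hl w z).1 hz
    · intro hg
      obtain ⟨z, hz, rfl⟩ := exists_valid_of_mem_translate hw hg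
      obtain ⟨z, rfl⟩ := hz.exists_unbound
      exact ⟨z, (hl w z).2 hg, rfl⟩
  · intro h
    refine (h.image fun Y => ({z | mk (c.unbound z) ∈ Y} : Language _)).subset ?_
    rintro L ⟨w, rfl⟩
    refine ⟨_, ⟨_, valid_unbound w, rfl⟩, ?_⟩
    ext z
    exact (hl w z).symm

/-! ### Saturation of the automaton. -/

/-- Composition of two labelled transitions, if the reduced label has length at most one. -/
def compose (t t' : ℕ × List (ℕ × Bool) × ℕ) : Option (ℕ × List (ℕ × Bool) × ℕ) :=
  if t.2.2 = t'.1 ∧ (reduce (t.2.1 ++ t'.2.1)).length ≤ 1 then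
    some (t.1, reduce (t.2.1 ++ t'.2.1), t'.2.2) else none

/-- One round of closing a list of transitions under composition. -/
def shortStep (G : List (ℕ × List (ℕ × Bool) × ℕ)) : List (ℕ × List (ℕ × Bool) × ℕ) :=
  G ++ G.flatMap fun t => G.filterMap fun t' => compose t t'

/-- The edge of the automaton as a transition, if its entries are in range. -/
def edgeTransition (c : AutomatonCode) (e : ℕ × (ℕ × Bool) × ℕ) :
    Option (ℕ × List (ℕ × Bool) × ℕ) :=
  if (e.1 < c.numStates ∧ e.2.2 < c.numStates) ∧ e.2.1.1 < c.rank then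
    some (e.1, [e.2.1], e.2.2) else none

/-- The empty transitions and the edges of the automaton. -/
def shortBase (c : AutomatonCode) : List (ℕ × List (ℕ × Bool) × ℕ) :=
  ((List.range c.numStates).map fun p => (p, [], p)) ++ c.edges.filterMap c.edgeTransition

/-- The transitions obtained after `k` rounds of composition. -/
def short (c : AutomatonCode) (k : ℕ) : List (ℕ × List (ℕ × Bool) × ℕ) :=
  shortStep^[k] c.shortBase

/-- A list of transitions that a further round of composition does not enlarge. -/
def Closed (G : List (ℕ × List (ℕ × Bool) × ℕ)) : Prop := ∀ t ∈ shortStep G, t ∈ G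

theorem mem_shortStep {G : List (ℕ × List (ℕ × Bool) × ℕ)} {t : ℕ × List (ℕ × Bool) × ℕ} :
    t ∈ shortStep G ↔ t ∈ G ∨ ∃ p u q v r, (p, u, q) ∈ G ∧ (q, v, r) ∈ G ∧
      (reduce (u ++ v)).length ≤ 1 ∧ t = (p, reduce (u ++ v), r) := by
  simp only [shortStep, List.mem_append, List.mem_flatMap, List.mem_filterMap, compose,
    Option.ite_none_right_eq_some, Option.some.injEq]
  refine or_congr_right ⟨?_, ?_⟩
  · rintro ⟨⟨p, u, q⟩, h, ⟨q', v, r⟩, h', ⟨rfl, hl⟩, rfl⟩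
    exact ⟨p, u, _, v, r, h, h', hl, rfl⟩
  · rintro ⟨p, u, q, v, r, h, h', hl, rfl⟩
    exact ⟨_, h, _, h', ⟨rfl, hl⟩, rfl⟩

theorem mem_shortBase {p q : ℕ} {u : List (ℕ × Bool)} :
    (p, u, q) ∈ c.shortBase ↔ (p < c.numStates ∧ u = [] ∧ p = q) ∨ ∃ x, u = [x] ∧ c.Edge p x q := by
  simp only [shortBase, List.mem_append, List.mem_map, List.mem_range, List.mem_filterMap,
    edgeTransition, Option.ite_none_right_eq_some, Option.some.injEq]
  refine or_congr ⟨?_, ?_⟩ ⟨?_, ?_⟩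
  · rintro ⟨a, h, e⟩
    cases e
    exact ⟨h, rfl, rfl⟩
  · rintro ⟨h, rfl, rfl⟩
    exact ⟨_, h, rfl⟩
  · rintro ⟨⟨p', x, q'⟩, h, ⟨⟨h1, h2⟩, h3⟩, e⟩
    cases e
    exact ⟨x, rfl, h, h1, h2, h3⟩
  · rintro ⟨x, rfl, h, h1, h2, h3⟩
    exact ⟨_, h, ⟨⟨h1, h2⟩, h3⟩, rfl⟩

theorem short_succ (k : ℕ) : c.short (k + 1) = shortStep (c.short k) :=
  Function.iterate_succ_apply' ..

theorem short_mono {k l : ℕ} (h : k ≤ l) : c.short k ⊆ c.short l := by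
  induction h with
  | refl => exact fun _ => id
  | step _ ih => exact fun t ht => short_succ (c := c) _ ▸ mem_shortStep.2 (.inl (ih ht))

theorem short_sound {k : ℕ} {p q : ℕ} {u : List (ℕ × Bool)} (h : (p, u, q) ∈ c.short k) :
    u.length ≤ 1 ∧ ∃ w, c.Path p w q ∧ reduce w = u := by
  induction k generalizing p q u with
  | zero =>
    rcases mem_shortBase.1 h with ⟨hp, rfl, rfl⟩ | ⟨x, rfl, hx⟩
    · exact ⟨by simp, [], ⟨rfl, hp⟩, rfl⟩
    · exact ⟨by simp, [x], ⟨q, hx, rfl, hx.2.2.1⟩, reduce_singleton x⟩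
  | succ k ih =>
    rw [short_succ, mem_shortStep] at h
    rcases h with h | ⟨p', u', r, v', q', h1, h2, hl, e⟩
    · exact ih h
    · cases e
      obtain ⟨-, w1, hw1, rfl⟩ := ih h1
      obtain ⟨-, w2, hw2, rfl⟩ := ih h2
      exact ⟨hl, w1 ++ w2, path_append_iff.2 ⟨r, hw1, hw2⟩, reduce_append_reduce_reduce.symm⟩

theorem finite_words (c : AutomatonCode) (m : ℕ) :
    {u : List (ℕ × Bool) | u.length ≤ m ∧ c.Valid u}.Finite := by
  refine ((List.finite_length_le (Fin c.rank × Bool) m).image c.unbound).subset ?_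
  rintro u ⟨hu, hv⟩
  obtain ⟨v, rfl⟩ := hv.exists_unbound
  exact ⟨v, by simpa [unbound] using hu, rfl⟩

/-- The stages increase inside a finite set, since labels have length at most one, so they
stabilize. No bound on `k` is computed: the certificates carry `k`. -/
theorem exists_closed (c : AutomatonCode) : ∃ k, Closed (c.short k) := by
  have hf : {t | ∃ k, t ∈ c.short k}.Finite := by
    refine ((Set.finite_Iio c.numStates).prod
      ((finite_words c 1).prod (Set.finite_Iio c.numStates))).subset ?_
    rintro ⟨p, u, q⟩ ⟨k, h⟩
    obtain ⟨hl, w, hw, rfl⟩ := short_sound h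
    exact ⟨hw.left_lt, ⟨hl, hw.valid.reduce⟩, hw.right_lt⟩
  choose! f hf' using fun (t) (ht : t ∈ {t | ∃ k, t ∈ c.short k}) => ht
  obtain ⟨K, hK⟩ := (hf.image f).bddAbove
  refine ⟨K, fun t ht => ?_⟩
  have : t ∈ {t | ∃ k, t ∈ c.short k} := ⟨K + 1, short_succ (c := c) K ▸ ht⟩
  exact short_mono (hK ⟨t, this, rfl⟩) (hf' t this)

theorem Closed.compose_mem {G : List (ℕ × List (ℕ × Bool) × ℕ)} (hG : Closed G) {p q r : ℕ}
    {u v : List (ℕ × Bool)} (h1 : (p, u, q) ∈ G) (h2 : (q, v, r) ∈ G)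
    (hl : (reduce (u ++ v)).length ≤ 1) : (p, reduce (u ++ v), r) ∈ G :=
  hG _ (mem_shortStep.2 (.inr ⟨p, u, q, v, r, h1, h2, hl, rfl⟩))

/-- A reduced word is reached only through its prefixes. -/
theorem Path.split {p q : ℕ} {w u v : List (ℕ × Bool)} (h : c.Path p w q)
    (e : reduce w = u ++ v) :
    ∃ r w1 w2, w1 ++ w2 = w ∧ c.Path p w1 r ∧ c.Path r w2 q ∧ reduce w1 = u ∧ reduce w2 = v := by
  -- A reduction to a concatenation comes from reductions of two consecutive pieces of the word.
  obtain ⟨w1, w2, rfl, h1, h2⟩ := Red.to_append_iff.1 (e ▸ reduce.red (L := w))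
  obtain ⟨r, hr1, hr2⟩ := path_append_iff.1 h
  have hr := isReduced_reduce (w1 ++ w2)
  rw [e, isReduced_append_iff] at hr
  exact ⟨r, w1, w2, rfl, hr1, hr2, (reduce.eq_of_red h1).trans hr.1.reduce_eq,
    (reduce.eq_of_red h2).trans hr.2.1.reduce_eq⟩

/-- Induction on the length of the path. Either the path after the first letter already has a short
reduced label, or the first letter cancels against the head of that label, and the path is split
there. -/
theorem short_complete {k : ℕ} (hk : Closed (c.short k)) {p q : ℕ} {w : List (ℕ × Bool)}
    (h : c.Path p w q) (hl : (reduce w).length ≤ 1) : (p, reduce w, q) ∈ c.short k := by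
  induction hn : w.length using Nat.strong_induction_on generalizing p q w with
  | _ n ih =>
    subst hn
    rcases w with _ | ⟨x, w⟩
    · exact short_mono (Nat.zero_le k) (mem_shortBase.2 (.inl ⟨h.2, rfl, h.1⟩))
    obtain ⟨r, h1, h2⟩ := h
    have hx : (p, [x], r) ∈ c.short k :=
      short_mono (Nat.zero_le k) (mem_shortBase.2 (.inr ⟨x, rfl, h1⟩))
    have hcons : reduce ([x] ++ reduce w) = reduce (x :: w) := reduce_cons_reduce x
    by_cases hw : (reduce w).length ≤ 1
    · have := hk.compose_mem hx (ih _ (by simp) h2 hw rfl) (by rw [hcons]; exact hl)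
      rwa [hcons] at this
    · rw [reduce_cons_eq] at hl
      split_ifs at hl with hh
      · rcases hr : reduce w with _ | ⟨y, t⟩
        · simp [hr] at hw
        obtain ⟨s, w1, w2, rfl, hw1, hw2, e1, e2⟩ := h2.split (u := [y]) (v := t) hr
        rw [hr] at hh hl hcons
        simp only [List.head?_cons, Option.some.injEq] at hh
        subst hh
        have m1 : (r, [bar x], s) ∈ c.short k := by
          have hpos : w2 ≠ [] := by
            rintro rfl
            simp only [reduce_nil] at e2
            rw [hr, ← e2] at hw
            simp at hw
          rw [← e1]
          refine ih _ ?_ hw1 (by simp [e1]) rfl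
          have := List.length_pos_of_ne_nil hpos
          simp only [List.length_cons, List.length_append]
          omega
        have m2 : (s, t, q) ∈ c.short k := by
          rw [← e2]
          refine ih _ ?_ hw2 (by simpa [e2] using hl) rfl
          simp only [List.length_cons, List.length_append]
          omega
        -- Composing `x` with `bar x` before appending `t` keeps every intermediate label of length
        -- at most one.
        have hc : reduce ([x] ++ [bar x]) = [] := by
          rw [List.singleton_append, reduce_cons_eq]
          simp
        have m3 := hk.compose_mem hx m1 (by rw [hc]; simp)
        rw [hc] at m3
        have ht : reduce t = t := by rw [← e2]; exact reduce.idem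
        have m4 := hk.compose_mem m3 m2 (by simpa [ht] using hl)
        have : reduce (x :: (w1 ++ w2)) = t := by
          rw [reduce_cons_eq, hr]
          simp
        rw [this]
        simpa [ht] using m4
      · simp only [List.length_cons] at hl
        omega

theorem mem_short_iff {k : ℕ} (hk : Closed (c.short k)) {p q : ℕ} {u : List (ℕ × Bool)} :
    (p, u, q) ∈ c.short k ↔ u.length ≤ 1 ∧ ∃ w, c.Path p w q ∧ reduce w = u := by
  refine ⟨short_sound, ?_⟩
  rintro ⟨hl, w, hw, rfl⟩
  exact short_complete hk hw hl

/-! ### Deterministic runs on reduced words. -/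

/-- The states reached at the empty reduced word. -/
def runStart (c : AutomatonCode) (G : List (ℕ × List (ℕ × Bool) × ℕ)) : List ℕ :=
  (List.range c.numStates).filter fun q => ∃ p ∈ c.initial, (p, [], q) ∈ G

/-- The states reached from a list of states along one reduced letter. -/
def advance (c : AutomatonCode) (G : List (ℕ × List (ℕ × Bool) × ℕ)) (S : List ℕ)
    (x : ℕ × Bool) : List ℕ :=
  (List.range c.numStates).filter fun q => ∃ p ∈ S, (p, [x], q) ∈ G

/-- The states reached at a reduced word. -/
def run (c : AutomatonCode) (G : List (ℕ × List (ℕ × Bool) × ℕ)) (w : List (ℕ × Bool)) : List ℕ :=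
  w.foldl (c.advance G) (c.runStart G)

theorem run_append (G : List (ℕ × List (ℕ × Bool) × ℕ)) (u v : List (ℕ × Bool)) :
    c.run G (u ++ v) = v.foldl (c.advance G) (c.run G u) := List.foldl_append

/-- Induction on the last letter: `Path.split` cuts a path reducing to `w ++ [x]` into one reducing
to `w` and one reducing to `[x]`, the latter being a saturated transition. -/
theorem mem_run_iff {k : ℕ} (hk : Closed (c.short k)) {w : List (ℕ × Bool)}
    (hw : IsReduced w) {q : ℕ} :
    q ∈ c.run (c.short k) w ↔ ∃ p ∈ c.initial, ∃ v, c.Path p v q ∧ reduce v = w := by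
  induction w using List.reverseRecOn generalizing q with
  | nil =>
    simp only [run, List.foldl_nil, runStart, List.mem_filter, List.mem_range, decide_eq_true_eq,
      mem_short_iff hk, List.length_nil, zero_le, true_and]
    refine ⟨fun h => h.2, fun h => ⟨?_, h⟩⟩
    obtain ⟨p, -, v, hv, -⟩ := h
    exact hv.right_lt
  | append_singleton w x ih =>
    have hw' := (isReduced_append_iff.1 hw).1
    simp only [run_append, List.foldl_cons, List.foldl_nil, advance, List.mem_filter,
      List.mem_range, decide_eq_true_eq, mem_short_iff hk, List.length_singleton, le_refl, true_and,
      ih hw']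
    constructor
    · rintro ⟨-, r, ⟨p, hp, v, hv, e⟩, v', hv', e'⟩
      refine ⟨p, hp, v ++ v', path_append_iff.2 ⟨r, hv, hv'⟩, ?_⟩
      rw [← reduce_append_reduce_reduce, e, e', hw.reduce_eq]
    · rintro ⟨p, hp, v, hv, e⟩
      obtain ⟨r, v1, v2, -, h1, h2, e1, e2⟩ := hv.split e
      exact ⟨hv.right_lt, r, ⟨p, hp, v1, h1, e1⟩, v2, h2, e2⟩

/-- A list of states that contains a final state. -/
def Accepting (c : AutomatonCode) (S : List ℕ) : Prop := ∃ q ∈ S, q ∈ c.final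

theorem mk_mem_carrier_iff {k : ℕ} (hk : Closed (c.short k)) {w : List (ℕ × Bool)} :
    mk w ∈ c.carrier ↔ c.Accepting (c.run (c.short k) (reduce w)) := by
  simp only [carrier, Accepting, Set.mem_ofPred_eq, mk_eq_iff, mem_run_iff hk (isReduced_reduce w)]
  constructor
  · rintro ⟨p, hp, q, hq, v, hv, e⟩
    exact ⟨q, ⟨p, hp, v, hv, e⟩, hq⟩
  · rintro ⟨q, ⟨p, hp, v, hv, e⟩, hq⟩
    exact ⟨p, hp, q, hq, v, hv, e⟩

/-! ### Finite invariants and types. -/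

/-- The translates are finite in number if they are determined by an invariant of reduced words
that takes finitely many values. -/
theorem finite_translates_of_invariant {β : Type*} {F : Set β} (hF : F.Finite)
    (t : List (ℕ × Bool) → β) (htF : ∀ w, c.Valid w → IsReduced w → t w ∈ F)
    (ht : ∀ u v, c.Valid u → IsReduced u → c.Valid v → IsReduced v → t u = t v →
      ∀ z, c.Valid z → mk (u ++ z) ∈ c.carrier → mk (v ++ z) ∈ c.carrier) :
    c.translates.Finite := by
  have h1 : ∀ Y ∈ c.translates, ∃ w, c.Valid w ∧ IsReduced w ∧ c.translate (mk w) = Y := by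
    rintro Y ⟨w, hw, rfl⟩
    exact ⟨reduce w, hw.reduce, isReduced_reduce w, by rw [reduce.self]⟩
  -- Pick a reduced representative of each translate; equal invariants give inclusions both ways, so
  -- the invariant is injective on translates.
  choose! f hv hr hf using h1
  have h2 : ∀ Y ∈ c.translates, ∀ Z ∈ c.translates, t (f Y) = t (f Z) → Y ⊆ Z := by
    intro Y hY Z hZ e g hg
    rw [← hf Y hY] at hg
    obtain ⟨z, hz, rfl⟩ := exists_valid_of_mem_translate (hv Y hY) hg
    rw [← hf Z hZ]
    rw [mem_translate, mul_mk] at hg ⊢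
    exact ht _ _ (hv Y hY) (hr Y hY) (hv Z hZ) (hr Z hZ) e z hz hg
  refine Set.Finite.of_injOn (f := fun Y => t (f Y)) (fun Y hY => htF _ (hv Y hY) (hr Y hY)) ?_ hF
  exact fun Y hY Z hZ e => (h2 Y hY Z hZ e).antisymm (h2 Z hZ Y hY e.symm)

theorem run_sublist (G : List (ℕ × List (ℕ × Bool) × ℕ)) (w : List (ℕ × Bool)) :
    (c.run G w).Sublist (List.range c.numStates) := by
  induction w using List.reverseRecOn with
  | nil => exact List.filter_sublist
  | append_singleton w x _ =>
    rw [run_append]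
    exact List.filter_sublist

/-- The possible pairs of a last letter and a list of states. -/
def types (c : AutomatonCode) : Set (Option (ℕ × Bool) × List ℕ) :=
  insert none (some '' (Set.Iio c.rank ×ˢ Set.univ)) ×ˢ
    {S | S ∈ (List.range c.numStates).sublists}

theorem finite_types (c : AutomatonCode) : c.types.Finite :=
  ((((Set.finite_Iio _).prod Set.finite_univ).image _).insert _).prod
    (List.finite_toSet _)

theorem mem_types (G : List (ℕ × List (ℕ × Bool) × ℕ)) {w : List (ℕ × Bool)} (hw : c.Valid w) :
    (w.getLast?, c.run G w) ∈ c.types := by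
  refine ⟨?_, List.mem_sublists.2 (run_sublist G w)⟩
  rcases h : w.getLast? with _ | x
  · exact Set.mem_insert _ _
  · exact Set.mem_insert_of_mem _ ⟨x, ⟨hw x (List.mem_of_getLast? h), trivial⟩, rfl⟩

/-! ### Certificates of non-recognizability. -/

/-- A witness that a rational subset is not recognizable: reduced words `g` and `h` with the same
last letter, at which the automaton reaches the same states, and a word `z` that separates them. -/
def Separates (c : AutomatonCode)
    (d : ℕ × List (ℕ × Bool) × List (ℕ × Bool) × List (ℕ × Bool)) : Prop :=
  Closed (c.short d.1) ∧ (c.Valid d.2.1 ∧ c.Valid d.2.2.1) ∧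
    (reduce d.2.1 = d.2.1 ∧ reduce d.2.2.1 = d.2.2.1) ∧
    d.2.1.getLast? = d.2.2.1.getLast? ∧
    c.run (c.short d.1) d.2.1 = c.run (c.short d.1) d.2.2.1 ∧
    c.Accepting (c.run (c.short d.1) (reduce (d.2.1 ++ d.2.2.2))) ∧
    ¬ c.Accepting (c.run (c.short d.1) (reduce (d.2.2.1 ++ d.2.2.2)))

/-- Without a separating triple the type of a reduced word determines its translate, and there are
finitely many types. -/
theorem exists_separates (h : ¬ c.translates.Finite) : ∃ d, c.Separates d := by
  contrapose! h
  obtain ⟨k, hk⟩ := exists_closed c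
  refine finite_translates_of_invariant c.finite_types
    (fun w => (w.getLast?, c.run (c.short k) w)) (fun w hw _ => mem_types _ hw) ?_
  intro u v hu hur hv hvr e z _ hz
  by_contra hz'
  rw [mk_mem_carrier_iff hk] at hz hz'
  simp only [Prod.mk.injEq] at e
  exact h (k, u, v, z) ⟨hk, ⟨hu, hv⟩, ⟨hur.reduce_eq, hvr.reduce_eq⟩, e.1, e.2, hz, hz'⟩

/-- Powers of an element of arbitrarily large exponent fix any two given translates. -/
theorem exists_pow_translate (hfin : c.translates.Finite) {g h : List (ℕ × Bool)}
    (hg : c.Valid g) (hh : c.Valid h) {x : ℕ × Bool} (hx : x.1 < c.rank) (n : ℕ) :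
    ∃ m > n, c.translate (mk g * mk [x] ^ m) = c.translate (mk g) ∧
      c.translate (mk h * mk [x] ^ m) = c.translate (mk h) := by
  have hmem : ∀ w, c.Valid w → ∀ m, c.translate (mk w * mk [x] ^ m) ∈ c.translates := by
    intro w hw m
    refine ⟨w ++ (List.replicate m [x]).flatten, valid_append.2 ⟨hw, fun y hy => ?_⟩, ?_⟩
    · simp only [List.mem_flatten, List.mem_replicate] at hy
      obtain ⟨l, ⟨-, rfl⟩, hy⟩ := hy
      rw [List.mem_singleton.1 hy]
      exact hx
    · rw [pow_mk, mul_mk]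
  have hf := hfin.prod hfin
  -- Pigeonhole on pairs of translates, so one exponent serves both words. Using multiples of `n +
  -- 1` makes the difference of two exponents exceed `n`.
  obtain ⟨i, -, j, -, hij, e⟩ := Set.infinite_univ.exists_lt_map_eq_of_mapsTo
    (t := c.translates ×ˢ c.translates) (f := fun i : ℕ => (c.translate (mk g * mk [x] ^ (i * (n + 1))),
      c.translate (mk h * mk [x] ^ (i * (n + 1)))))
    (fun i _ => ⟨hmem g hg _, hmem h hh _⟩) hf
  obtain ⟨l, rfl⟩ := Nat.exists_eq_add_of_lt hij
  have hexp : (i + l + 1) * (n + 1) = (l + 1) * (n + 1) + i * (n + 1) := by ring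
  simp only [Prod.mk.injEq, hexp, pow_add, ← mul_assoc, translate_mul_inj] at e
  refine ⟨(l + 1) * (n + 1), by nlinarith, ?_⟩
  simpa only [pow_add, ← mul_assoc] using And.intro e.1.symm e.2.symm

/-- With finitely many translates, a long power of the common last letter can be inserted before `z`
without changing membership; it shields `g` and `h` from cancellation. -/
theorem Separates.not_finite {d : ℕ × List (ℕ × Bool) × List (ℕ × Bool) × List (ℕ × Bool)}
    (hd : c.Separates d) : ¬ c.translates.Finite := by
  obtain ⟨k, g, h, z⟩ := d
  obtain ⟨hk, ⟨hg, hh⟩, ⟨hgr, hhr⟩, hlast, hrun, hacc, hrej⟩ := hd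
  dsimp only at hk hg hh hgr hhr hlast hrun hacc hrej
  intro hfin
  rw [← mk_mem_carrier_iff hk] at hacc hrej
  -- Without a last letter both words are empty, and `z` cannot separate them.
  rcases hl : g.getLast? with _ | x
  · rw [hl] at hlast
    rw [List.getLast?_eq_none_iff.1 hl] at hacc
    rw [List.getLast?_eq_none_iff.1 hlast.symm] at hrej
    exact hrej hacc
  have hx : x.1 < c.rank := hg x (List.mem_of_getLast? hl)
  obtain ⟨m, hm, eg, eh⟩ := exists_pow_translate hfin hg hh hx z.length
  obtain ⟨t, ht⟩ : ∃ t, reduce (List.replicate m x ++ z) = x :: t := by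
    rcases reduce_replicate_append x z m with h | h
    · exact h
    · omega
  have hxt : IsReduced (x :: t) := ht ▸ isReduced_reduce _
  have key : ∀ w, reduce w = w → w.getLast? = some x →
      c.translate (mk w * mk [x] ^ m) = c.translate (mk w) →
      (mk (w ++ z) ∈ c.carrier ↔
        c.Accepting ((x :: t).foldl (c.advance (c.short k)) (c.run (c.short k) w))) := by
    intro w hw hwx e
    -- Both sides of the junction carry the letter `x`, so nothing cancels there.
    have hred : IsReduced (w ++ x :: t) := by
      refine isReduced_append_iff.2 ⟨isReduced_iff_reduce_eq.2 hw, hxt, ?_⟩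
      simp only [hwx, List.head?_cons, Option.mem_def, Option.some.injEq, forall_eq']
      exact ne_bar_iff.2 fun _ => rfl
    rw [← mul_mk, ← mem_translate, ← e, mem_translate, mul_assoc, pow_mk, mul_mk]
    have : (List.replicate m [x]).flatten = List.replicate m x := by simp
    rw [this, ← reduce.self (L := List.replicate m x ++ z), ht, mul_mk, mk_mem_carrier_iff hk,
      hred.reduce_eq, run_append]
  rw [key g hgr hl eg, hrun, ← key h hhr (hlast ▸ hl) eh] at hacc
  exact hrej hacc

/-! ### Certificates of recognizability. -/

/-- The letters over the first `c.rank` generators. -/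
def letters (c : AutomatonCode) : List (ℕ × Bool) :=
  (List.range c.rank).flatMap fun i => [(i, true), (i, false)]

theorem mem_letters {x : ℕ × Bool} : x ∈ c.letters ↔ x.1 < c.rank := by
  obtain ⟨i, b⟩ := x
  cases b <;> simp [letters]

/-- The action of letters on numbers that is written out in a table. -/
def act (tab : List ℕ) (i : ℕ) (x : ℕ × Bool) : ℕ := tab.getD (Encodable.encode (i, x)) 0

/-- A witness that a rational subset is recognizable: an action of the free group on `{0, …, m-1}`
with a base point `s`, and a list `R` that pairs the last letter and the states reached at a
reduced word with the image of `s` under the word, such that acceptance depends only on the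
latter. -/
def Recognizes (c : AutomatonCode)
    (d : ℕ × (ℕ × ℕ × List ℕ × List ℕ) × List ((Option (ℕ × Bool) × List ℕ) × ℕ)) : Prop :=
  Closed (c.short d.1) ∧ d.2.1.2.1 < d.2.1.1 ∧
    ((none, c.runStart (c.short d.1)), d.2.1.2.1) ∈ d.2.2 ∧
    (∀ r ∈ d.2.2, (c.Accepting r.1.2 ↔ r.2 ∈ d.2.1.2.2.2) ∧
      ∀ x ∈ c.letters, r.1.1 ≠ some (bar x) →
        ((some x, c.advance (c.short d.1) r.1.2 x), act d.2.1.2.2.1 r.2 x) ∈ d.2.2) ∧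
    ∀ i < d.2.1.1, ∀ x ∈ c.letters, act d.2.1.2.2.1 i x < d.2.1.1 ∧
      act d.2.1.2.2.1 (act d.2.1.2.2.1 i x) (bar x) = i

/-- The image of the base point is unchanged by free reduction and, through `R`, decides membership.
It is thus an invariant with fewer than `m + 1` values that determines the translate. -/
theorem Recognizes.finite
    {d : ℕ × (ℕ × ℕ × List ℕ × List ℕ) × List ((Option (ℕ × Bool) × List ℕ) × ℕ)}
    (hd : c.Recognizes d) : c.translates.Finite := by
  obtain ⟨k, ⟨m, s, tab, A⟩, R⟩ := d
  obtain ⟨hk, hs, hR0, hR, hact⟩ := hd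
  dsimp only at hk hs hR0 hR hact
  have hlt : ∀ w i, c.Valid w → i < m → w.foldl (act tab) i < m := by
    intro w
    induction w with
    | nil => exact fun i _ hi => hi
    | cons x w ih =>
      intro i hw hi
      exact ih _ (fun y hy => hw y (List.mem_cons_of_mem _ hy))
        (hact i hi x (mem_letters.2 (hw x List.mem_cons_self))).1
  have hstep : ∀ u v, Red u v → c.Valid u → u.foldl (act tab) s = v.foldl (act tab) s := by
    intro u v huv hu
    induction huv using Relation.ReflTransGen.head_induction_on with
    | refl => rfl
    | head h _ ih =>
      rw [← ih fun y hy => hu y (h.sublist.subset hy)]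
      cases h with
      | @not u v x b =>
        obtain ⟨h1, h2⟩ := valid_append.1 hu
        have h3 := (hact _ (hlt u s h1 hs) (x, b) (mem_letters.2 (h2 _ List.mem_cons_self))).2
        simp only [bar] at h3
        simp only [List.foldl_append, List.foldl_cons, h3]
  -- `R` is only assumed closed under appending letters that do not cancel, which is enough to reach
  -- every reduced word.
  have hmem : ∀ w, c.Valid w → IsReduced w →
      ((w.getLast?, c.run (c.short k) w), w.foldl (act tab) s) ∈ R := by
    intro w
    induction w using List.reverseRecOn with
    | nil => exact fun _ _ => hR0
    | append_singleton w x ih =>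
      intro hv hr
      obtain ⟨hv1, hv2⟩ := valid_append.1 hv
      obtain ⟨hr1, hr2⟩ := isReduced_concat_iff.1 hr
      have := (hR _ (ih hv1 hr1)).2 x (mem_letters.2 (hv2 x (by simp))) hr2
      simpa [run_append] using this
  have hcar : ∀ w, c.Valid w → (mk w ∈ c.carrier ↔ w.foldl (act tab) s ∈ A) := by
    intro w hw
    rw [mk_mem_carrier_iff hk, (hR _ (hmem _ hw.reduce (isReduced_reduce w))).1,
      hstep w _ reduce.red hw]
  refine finite_translates_of_invariant (Set.finite_Iio m) (fun w => w.foldl (act tab) s)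
    (fun w hw _ => hlt w s hw hs) ?_
  intro u v hu _ hv _ e z hz h
  rw [hcar _ (valid_append.2 ⟨hu, hz⟩), List.foldl_append, e, ← List.foldl_append] at h
  exact (hcar _ (valid_append.2 ⟨hv, hz⟩)).2 h

/-- The translate of a subset by the inverse of a letter. -/
def shift (x : ℕ × Bool) (Y : Set (FreeGroup ℕ)) : Set (FreeGroup ℕ) := {z | mk [x] * z ∈ Y}

theorem shift_translate (w : List (ℕ × Bool)) (x : ℕ × Bool) :
    shift x (c.translate (mk w)) = c.translate (mk (w ++ [x])) := by
  ext z
  rw [mem_translate, ← mul_mk, mul_assoc]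
  rfl

theorem shift_bar_shift (x : ℕ × Bool) (Y : Set (FreeGroup ℕ)) : shift (bar x) (shift x Y) = Y := by
  ext z
  change mk [x] * (mk [bar x] * z) ∈ Y ↔ z ∈ Y
  rw [mk_bar, mul_inv_cancel_left]

theorem shift_mem_translates {x : ℕ × Bool} (hx : x.1 < c.rank) {Y : Set (FreeGroup ℕ)}
    (hY : Y ∈ c.translates) : shift x Y ∈ c.translates := by
  obtain ⟨w, hw, rfl⟩ := hY
  exact ⟨w ++ [x], valid_append.2 ⟨hw, by simpa [Valid] using hx⟩, (shift_translate w x).symm⟩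

theorem exists_numbering {β : Type*} {F : Set β} (hF : F.Finite) (hne : F.Nonempty) :
    ∃ (m : ℕ) (enc : β → ℕ) (dec : ℕ → β), (∀ y ∈ F, enc y < m ∧ dec (enc y) = y) ∧
      ∀ i < m, dec i ∈ F ∧ enc (dec i) = i := by
  classical
  obtain ⟨y₀, hy₀⟩ := hne
  have := hF.to_subtype
  obtain ⟨m, ⟨e⟩⟩ := Finite.exists_equiv_fin F
  refine ⟨m, fun y => if h : y ∈ F then e ⟨y, h⟩ else 0,
    fun i => if h : i < m then e.symm ⟨i, h⟩ else y₀, ?_, ?_⟩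
  · intro y hy
    simp [hy]
  · intro i hi
    simp [hi]

/-- Every function of finitely many numbers and letters is written out in some table. -/
theorem exists_table (m n : ℕ) (f : ℕ → ℕ × Bool → ℕ) :
    ∃ tab, ∀ i < m, ∀ x : ℕ × Bool, x.1 < n → act tab i x = f i x := by
  -- The table is indexed by codes of pairs (number, letter); `M` bounds the finitely many codes
  -- that matter.
  obtain ⟨M, hM⟩ := ((((Set.finite_Iio m).prod ((Set.finite_Iio n).prod
    (Set.finite_univ (α := Bool)))).image Encodable.encode)).bddAbove
  refine ⟨(List.range (M + 1)).map fun j =>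
    ((Encodable.decode j : Option (ℕ × ℕ × Bool)).map fun p => f p.1 p.2).getD 0, ?_⟩
  intro i hi x hx
  have : Encodable.encode (i, x) < M + 1 :=
    Nat.lt_succ_of_le (hM ⟨(i, x), ⟨hi, hx, trivial⟩, rfl⟩)
  rw [act, List.getD_eq_getElem _ _ (by simpa using this)]
  simp only [List.getElem_map, List.getElem_range, Encodable.encodek]
  rfl

/-- The free group acts on the finite set of translates by `shift`. Number the translates, take X
itself as base point, and let `R` collect the pairs that actually occur. -/
theorem exists_recognizes (h : c.translates.Finite) : ∃ d, c.Recognizes d := by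
  classical
  obtain ⟨k, hk⟩ := exists_closed c
  obtain ⟨m, enc, dec, he, hd⟩ := exists_numbering h ⟨_, [], by simp [Valid], rfl⟩
  obtain ⟨tab, htab⟩ := exists_table m c.rank fun i x => enc (shift x (dec i))
  have ht : ∀ w, c.Valid w → c.translate (mk w) ∈ c.translates := fun w hw => ⟨w, hw, rfl⟩
  have hactt : ∀ w, c.Valid w → ∀ x : ℕ × Bool, x.1 < c.rank →
      act tab (enc (c.translate (mk w))) x = enc (c.translate (mk (w ++ [x]))) := by
    intro w hw x hx
    rw [htab _ (he _ (ht w hw)).1 x hx, (he _ (ht w hw)).2, shift_translate]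
  have hRfin : {r : (Option (ℕ × Bool) × List ℕ) × ℕ | ∃ w, c.Valid w ∧ IsReduced w ∧
      ((w.getLast?, c.run (c.short k) w), enc (c.translate (mk w))) = r}.Finite := by
    refine (c.finite_types.prod (Set.finite_Iio m)).subset ?_
    rintro _ ⟨w, hw, -, rfl⟩
    exact ⟨mem_types _ hw, (he _ (ht w hw)).1⟩
  refine ⟨(k, (m, enc (c.translate (mk [])), tab,
    -- An element g lies in X iff 1 lies in g⁻¹X.
    (List.range m).filter fun i => (1 : FreeGroup ℕ) ∈ dec i), hRfin.toFinset.toList),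
    hk, (he _ (ht [] (by simp [Valid]))).1, ?_, ?_, ?_⟩
  · simp only [Finset.mem_toList, Set.Finite.mem_toFinset]
    exact ⟨[], by simp [Valid], IsReduced.nil, rfl⟩
  · intro r hr
    simp only [Finset.mem_toList, Set.Finite.mem_toFinset] at hr
    obtain ⟨w, hw, hwr, rfl⟩ := hr
    refine ⟨?_, fun x hx hxl => ?_⟩
    · have := mk_mem_carrier_iff hk (w := w)
      rw [hwr.reduce_eq] at this
      rw [← this]
      simp only [List.mem_filter, List.mem_range, (he _ (ht w hw)).1, (he _ (ht w hw)).2, true_and,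
        decide_eq_true_eq, mem_translate, mul_one]
    · simp only [Finset.mem_toList, Set.Finite.mem_toFinset]
      rw [mem_letters] at hx
      refine ⟨w ++ [x], valid_append.2 ⟨hw, by simpa [Valid] using hx⟩,
        isReduced_concat_iff.2 ⟨hwr, hxl⟩, ?_⟩
      rw [hactt w hw x hx, run_append]
      simp
  · intro i hi x hx
    rw [mem_letters] at hx
    have hsh := shift_mem_translates hx (hd i hi).1
    dsimp only
    -- `hx` also bounds `bar x`, which has the same generator index.
    rw [htab i hi x hx, htab _ (he _ hsh).1 (bar x) hx, (he _ hsh).2, shift_bar_shift]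
    exact ⟨(he _ hsh).1, (hd i hi).2⟩

end AutomatonCode

/-! ### Primitive recursive verification of certificates. -/

open Primrec in
/-- The projection of a primitive recursive relation is recursively enumerable. -/
theorem _root_.PrimrecRel.rePred_exists {α β : Type*} [Primcodable α] [Primcodable β]
    {R : α → β → Prop} (hR : PrimrecRel R) : REPred fun a => ∃ b, R a b := by
  classical
  let f : α → ℕ → Option Unit := fun a n =>
    (Encodable.decode n : Option β).bind fun b => if R a b then some () else none
  have hf : Primrec₂ f := by
    refine option_bind (Primrec.decode.comp snd) ?_
    exact ite (hR.comp (fst.comp fst) snd) (const _) (const _)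
  -- Unbounded search over the codes of witnesses halts exactly when a witness exists.
  refine (Partrec.rfindOpt hf.to_comp).dom_re.of_eq fun a => ?_
  rw [Nat.rfindOpt_dom]
  simp only [f, Option.mem_def, Option.bind_eq_some_iff, Option.ite_none_right_eq_some]
  constructor
  · rintro ⟨n, -, b, -, hb, -⟩
    exact ⟨b, hb⟩
  · rintro ⟨b, hb⟩
    exact ⟨Encodable.encode b, (), b, Encodable.encodek b, hb, trivial⟩

section Quantifiers

open Primrec

variable {α β σ : Type*} [Primcodable α] [Primcodable β] [Primcodable σ]

theorem _root_.PrimrecPred.forall_mem {f : α → List β} {R : α → β → Prop} (hf : Primrec f)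
    (hR : PrimrecRel R) : PrimrecPred fun a => ∀ b ∈ f a, R a b :=
  hR.swap.forall_mem_list.comp hf .id

theorem _root_.PrimrecPred.exists_mem {f : α → List β} {R : α → β → Prop} (hf : Primrec f)
    (hR : PrimrecRel R) : PrimrecPred fun a => ∃ b ∈ f a, R a b :=
  hR.swap.exists_mem_list.comp hf .id

theorem _root_.PrimrecPred.mem_list {f : α → β} {g : α → List β} (hf : Primrec f)
    (hg : Primrec g) : PrimrecPred fun a => f a ∈ g a :=
  (PrimrecPred.exists_mem hg (R := fun a b => b = f a)
    (Primrec.eq.comp snd (hf.comp fst))).of_eq fun a => by simp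

theorem _root_.PrimrecPred.imp {p q : α → Prop} (hp : PrimrecPred p) (hq : PrimrecPred q) :
    PrimrecPred fun a => p a → q a :=
  (hp.not.or hq).of_eq fun a => by tauto

theorem _root_.PrimrecPred.iff {p q : α → Prop} (hp : PrimrecPred p) (hq : PrimrecPred q) :
    PrimrecPred fun a => p a ↔ q a :=
  ((hp.imp hq).and (hq.imp hp)).of_eq fun a => by tauto

theorem _root_.Primrec.list_filter {f : α → List β} {R : α → β → Prop} [∀ a b, Decidable (R a b)]
    (hf : Primrec f) (hR : PrimrecRel R) :
    Primrec fun a => (f a).filter fun b => decide (R a b) := by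
  classical
  exact (hR.swap.listFilter.comp hf .id).of_eq fun a =>
    List.filter_congr fun b _ => by simp [Function.swap]

end Quantifiers

open Primrec

theorem primrec_bar : Primrec bar := fst.pair (Primrec.not.comp snd)

/-- By `reduce_cons_eq`, free reduction is a right fold that looks only at the head of the part
already reduced. -/
theorem primrec_reduce : Primrec (reduce : List (ℕ × Bool) → List (ℕ × Bool)) := by
  have h : Primrec fun w : List (ℕ × Bool) => w.foldr (fun x r =>
      if r.head? = some (bar x) then r.tail else x :: r) [] := by
    refine list_foldr (h := fun _ p => if p.2.head? = some (bar p.1) then p.2.tail else p.1 :: p.2)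
      .id (const []) ?_
    refine ite (Primrec.eq.comp (list_head?.comp (snd.comp snd))
      (option_some.comp (primrec_bar.comp (fst.comp snd)))) (list_tail.comp (snd.comp snd)) ?_
    exact list_cons.comp (fst.comp snd) (snd.comp snd)
  refine h.of_eq fun w => ?_
  induction w with
  | nil => rfl
  | cons x w ih => rw [List.foldr_cons, ih, reduce_cons_eq]

theorem primrec_getLast? {α : Type*} [Primcodable α] : Primrec (List.getLast? : List α → Option α) :=
  (list_head?.comp list_reverse).of_eq fun _ => List.head?_reverse

namespace AutomatonCode

theorem primrec_rank : Primrec rank := fst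

theorem primrec_numStates : Primrec numStates := fst.comp snd

theorem primrec_initial : Primrec initial := fst.comp (snd.comp snd)

theorem primrec_final : Primrec final := fst.comp (snd.comp (snd.comp snd))

theorem primrec_edges : Primrec edges := snd.comp (snd.comp (snd.comp snd))

theorem primrec_compose : Primrec₂ compose := by
  have h : Primrec₂ fun t t' : ℕ × List (ℕ × Bool) × ℕ => reduce (t.2.1 ++ t'.2.1) :=
    primrec_reduce.comp (list_append.comp (fst.comp (snd.comp fst)) (fst.comp (snd.comp snd)))
  refine ite (PrimrecPred.and (Primrec.eq.comp (snd.comp (snd.comp fst)) (fst.comp snd))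
    (nat_le.comp (list_length.comp h) (const 1))) ?_ (const none)
  exact option_some.comp ((fst.comp fst).pair (Primrec.pair h (snd.comp (snd.comp snd))))

theorem primrec_shortStep : Primrec shortStep := by
  refine list_append.comp .id (list_flatMap .id ?_)
  exact listFilterMap fst (primrec_compose.comp (snd.comp fst) snd)

theorem primrec_edgeTransition : Primrec₂ edgeTransition := by
  refine ite (((nat_lt.comp (fst.comp snd) (primrec_numStates.comp fst)).and
    (nat_lt.comp (snd.comp (snd.comp snd)) (primrec_numStates.comp fst))).and
    (nat_lt.comp (fst.comp (fst.comp (snd.comp snd))) (primrec_rank.comp fst))) ?_ (const none)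
  exact option_some.comp ((fst.comp snd).pair
    ((list_cons.comp (fst.comp (snd.comp snd)) (const [])).pair (snd.comp (snd.comp snd))))

theorem primrec_shortBase : Primrec shortBase := by
  refine list_append.comp (list_map (list_range.comp primrec_numStates) ?_)
    (listFilterMap primrec_edges primrec_edgeTransition)
  exact snd.pair ((const []).pair snd)

theorem primrec_short : Primrec₂ short :=
  nat_iterate snd (primrec_shortBase.comp fst) (primrec_shortStep.comp snd)

theorem primrec_closed : PrimrecPred Closed :=
  PrimrecPred.forall_mem primrec_shortStep (PrimrecPred.mem_list snd fst)

section

variable {α : Type*} [Primcodable α] {c : α → AutomatonCode}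
  {G : α → List (ℕ × List (ℕ × Bool) × ℕ)}

theorem primrec_runStart (hc : Primrec c) (hG : Primrec G) :
    Primrec fun a => (c a).runStart (G a) := by
  refine list_filter (list_range.comp (primrec_numStates.comp hc)) ?_
  refine PrimrecPred.exists_mem (primrec_initial.comp (hc.comp fst)) ?_
  exact PrimrecPred.mem_list (snd.pair ((const []).pair (snd.comp fst)))
    (hG.comp (fst.comp fst))

theorem primrec_advance {S : α → List ℕ} {x : α → ℕ × Bool} (hc : Primrec c) (hG : Primrec G)
    (hS : Primrec S) (hx : Primrec x) : Primrec fun a => (c a).advance (G a) (S a) (x a) := by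
  refine list_filter (list_range.comp (primrec_numStates.comp hc)) ?_
  refine PrimrecPred.exists_mem (hS.comp fst) ?_
  exact PrimrecPred.mem_list (snd.pair ((list_cons.comp (hx.comp (fst.comp fst)) (const [])).pair
    (snd.comp fst))) (hG.comp (fst.comp fst))

theorem primrec_run {w : α → List (ℕ × Bool)} (hc : Primrec c) (hG : Primrec G)
    (hw : Primrec w) : Primrec fun a => (c a).run (G a) (w a) :=
  list_foldl (h := fun a p => (c a).advance (G a) p.1 p.2) hw (primrec_runStart hc hG)
    (primrec_advance (hc.comp fst) (hG.comp fst) (fst.comp snd) (snd.comp snd))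

theorem primrec_accepting {S : α → List ℕ} (hc : Primrec c) (hS : Primrec S) :
    PrimrecPred fun a => (c a).Accepting (S a) :=
  PrimrecPred.exists_mem hS (PrimrecPred.mem_list snd (primrec_final.comp (hc.comp fst)))

theorem primrec_valid {w : α → List (ℕ × Bool)} (hc : Primrec c) (hw : Primrec w) :
    PrimrecPred fun a => (c a).Valid (w a) :=
  PrimrecPred.forall_mem hw (nat_lt.comp (fst.comp snd) (primrec_rank.comp (hc.comp fst)))

theorem primrec_letters (hc : Primrec c) : Primrec fun a => (c a).letters := by
  refine list_flatMap (list_range.comp (primrec_rank.comp hc)) ?_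
  exact list_cons.comp (snd.pair (const true)) (list_cons.comp (snd.pair (const false)) (const []))

theorem primrec_act {tab : α → List ℕ} {i : α → ℕ} {x : α → ℕ × Bool} (ht : Primrec tab)
    (hi : Primrec i) (hx : Primrec x) : Primrec fun a => act (tab a) (i a) (x a) :=
  (list_getD 0).comp ht (Primrec.encode.comp (hi.pair hx))

end

theorem primrec_separates : PrimrecRel Separates := by
  let D := ℕ × List (ℕ × Bool) × List (ℕ × Bool) × List (ℕ × Bool)
  have hc : Primrec fun a : AutomatonCode × D => a.1 := fst
  have hG : Primrec fun a : AutomatonCode × D => a.1.short a.2.1 :=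
    primrec_short.comp fst (fst.comp snd)
  have hg : Primrec fun a : AutomatonCode × D => a.2.2.1 := fst.comp (snd.comp snd)
  have hh : Primrec fun a : AutomatonCode × D => a.2.2.2.1 := fst.comp (snd.comp (snd.comp snd))
  have hz : Primrec fun a : AutomatonCode × D => a.2.2.2.2 := snd.comp (snd.comp (snd.comp snd))
  have hr : ∀ {w : AutomatonCode × D → List (ℕ × Bool)}, Primrec w →
      PrimrecPred fun a : AutomatonCode × D => a.1.Accepting (a.1.run (a.1.short a.2.1) (reduce (w a ++ a.2.2.2.2))) :=
    fun hw => primrec_accepting hc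
      (primrec_run hc hG (primrec_reduce.comp (list_append.comp hw hz)))
  exact (primrec_closed.comp hG).and <| ((primrec_valid hc hg).and (primrec_valid hc hh)).and <|
    ((Primrec.eq.comp (primrec_reduce.comp hg) hg).and
      (Primrec.eq.comp (primrec_reduce.comp hh) hh)).and <|
    (Primrec.eq.comp (primrec_getLast?.comp hg) (primrec_getLast?.comp hh)).and <|
    (Primrec.eq.comp (primrec_run hc hG hg) (primrec_run hc hG hh)).and <|
    (hr hg).and (hr hh).not

theorem primrec_recognizes : PrimrecRel Recognizes := by
  let D := ℕ × (ℕ × ℕ × List ℕ × List ℕ) × List ((Option (ℕ × Bool) × List ℕ) × ℕ)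
  have hc : Primrec fun a : AutomatonCode × D => a.1 := fst
  have hG : Primrec fun a : AutomatonCode × D => a.1.short a.2.1 :=
    primrec_short.comp fst (fst.comp snd)
  have hd : Primrec fun a : AutomatonCode × D => a.2.2.1 := fst.comp (snd.comp snd)
  have hm : Primrec fun a : AutomatonCode × D => a.2.2.1.1 := fst.comp hd
  have hs : Primrec fun a : AutomatonCode × D => a.2.2.1.2.1 := fst.comp (snd.comp hd)
  have ht : Primrec fun a : AutomatonCode × D => a.2.2.1.2.2.1 := fst.comp (snd.comp (snd.comp hd))
  have hA : Primrec fun a : AutomatonCode × D => a.2.2.1.2.2.2 := snd.comp (snd.comp (snd.comp hd))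
  have hR : Primrec fun a : AutomatonCode × D => a.2.2.2 := snd.comp (snd.comp snd)
  refine (primrec_closed.comp hG).and <| (nat_lt.comp hs hm).and <|
    (PrimrecPred.mem_list (((const none).pair (primrec_runStart hc hG)).pair hs) hR).and <|
    PrimrecPred.and ?_ ?_
  · refine PrimrecPred.forall_mem hR (PrimrecPred.and ?_ ?_)
    · exact (primrec_accepting (hc.comp fst) (snd.comp (fst.comp snd))).iff
        (PrimrecPred.mem_list (snd.comp snd) (hA.comp fst))
    · refine PrimrecPred.forall_mem (primrec_letters (hc.comp fst)) (PrimrecPred.imp ?_ ?_)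
      · exact (Primrec.eq.comp (fst.comp (fst.comp (snd.comp fst)))
          (option_some.comp (primrec_bar.comp snd))).not
      · have h1 := hc.comp (fst.comp (fst (α := (AutomatonCode × D) ×
          ((Option (ℕ × Bool) × List ℕ) × ℕ)) (β := ℕ × Bool)))
        exact PrimrecPred.mem_list (((option_some.comp snd).pair
          (primrec_advance h1 (hG.comp (fst.comp fst)) (snd.comp (fst.comp (snd.comp fst))) snd)).pair
          (primrec_act (ht.comp (fst.comp fst)) (snd.comp (snd.comp fst)) snd))
          (hR.comp (fst.comp fst))
  · have h : PrimrecPred fun a : AutomatonCode × D => ∀ i ∈ List.range a.2.2.1.1,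
        ∀ x ∈ a.1.letters, act a.2.2.1.2.2.1 i x < a.2.2.1.1 ∧
          act a.2.2.1.2.2.1 (act a.2.2.1.2.2.1 i x) (bar x) = i := by
      refine PrimrecPred.forall_mem (list_range.comp hm)
        (PrimrecPred.forall_mem (primrec_letters (hc.comp fst)) ?_)
      have h2 := primrec_act (ht.comp (fst.comp (fst (α := (AutomatonCode × D) × ℕ)
        (β := ℕ × Bool)))) (snd.comp fst) snd
      exact (nat_lt.comp h2 (hm.comp (fst.comp fst))).and (Primrec.eq.comp
        (primrec_act (ht.comp (fst.comp fst)) h2 (primrec_bar.comp snd)) (snd.comp fst))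
    exact h.of_eq fun a => by simp only [List.mem_range]

end AutomatonCode
end RatFree

open RatFree RatFree.AutomatonCode in
-- Post's theorem: each side is the projection of a primitive recursive certificate relation.
theorem mainTheorem10 :
    ComputablePred (fun c : RatFree.AutomatonCode => RatFree.IsRecognizable c.ratSubset) := by
  refine ComputablePred.computable_iff_re_compl_re'.2 ⟨?_, ?_⟩
  · refine primrec_recognizes.rePred_exists.of_eq fun c => ?_
    rw [isRecognizable_iff]
    exact ⟨fun ⟨_, hd⟩ => hd.finite, exists_recognizes⟩
  · refine primrec_separates.rePred_exists.of_eq fun c => ?_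
    rw [isRecognizable_iff]
    exact ⟨fun ⟨_, hd⟩ => hd.not_finite, exists_separates⟩
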